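/- Let $J$ be a random variable with values in $\{-j^*,-j^*+1,\dots,0,1\}$ for some $j^*\in\mathbb N$ and with $\mathbb E(J)>0$. Let $\mathcal T_1$ be the following random labelled plane tree. Its genealogical structure is a Galton–Watson tree whose offspring distribution is geometric with parameter $1/2$, i.e. each node independently has $k$ children with probability $2^{-(k+1)}$, $k\ge 0$. The edges carry i.i.d. labels distributed as $J$, independent of the genealogical structure. The root has label $1$, and the label of any other node is the label of its parent plus the label of the edge between them. Call a node killed if its label is strictly smaller than the label of the root while every strict ancestor of it has a label at least that of the root, and let $B(\mathcal T_1)$ be the tree obtained from $\mathcal T_1$ by removing all strict descendants of killed nodes (the killed nodes themselves are kept). Let $\psi^*(B(\mathcal T_1))$ be the largest label of a node of $B(\mathcal T_1)$. Then $$u\,\mathbb P\bigl(\psi^*(B(\mathcal T_1))\ge u\bigr)\longrightarrow \frac{(\mathbb E(J))^2}{\mathbb P(J=1)}\qquad\text{as } u\to+\infty .$$ -/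

import Mathlib

open MeasureTheory ProbabilityTheory Filter Topology

/-- A rooted, oriented (plane) tree with real labels on its edges and on its root, in
Ulam–Harris notation: the root is `[]` and the children of `v` are `v ++ [0], v ++ [1], …`.
`edgeLabel v` is the label of the edge between the node `v ≠ []` and its parent;
its value at `[]` and at words that are not nodes carries no meaning. -/
structure LabelledTree where
  nodes : Set (List ℕ)
  root_mem : [] ∈ nodes
  parent_mem : ∀ (v : List ℕ) (i : ℕ), v ++ [i] ∈ nodes → v ∈ nodes
  sibling_mem : ∀ (v : List ℕ) (i j : ℕ), j ≤ i → v ++ [i] ∈ nodes → v ++ [j] ∈ nodes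
  rootLabel : ℝ
  edgeLabel : List ℕ → ℝ

namespace LabelledTree

/-- The label of the node `v`: the label of the root plus the labels of all edges on the path
from the root to `v`. -/
def label (T : LabelledTree) (v : List ℕ) : ℝ :=
  T.rootLabel + ∑ k ∈ Finset.range v.length, T.edgeLabel (v.take (k + 1))

/-- The killed nodes: their label is smaller than that of the root, while all their strict
ancestors have a label at least that of the root. -/
def killed (T : LabelledTree) : Set (List ℕ) :=
  {v | v ∈ T.nodes ∧ (∀ w, w <+: v → w ≠ v → T.label [] ≤ T.label w) ∧ T.label v < T.label []}

/-- The tree `B(T)`: all strict descendants of the killed nodes are removed, the killed nodes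
themselves are kept, and the labels are unchanged. -/
def barrier (T : LabelledTree) : LabelledTree where
  nodes := {v | v ∈ T.nodes ∧ ∀ w ∈ T.killed, w <+: v → w = v}
  root_mem := ⟨T.root_mem, fun _ _ h => List.prefix_nil.1 h⟩
  parent_mem := by
    rintro v i ⟨hv, hk⟩
    refine ⟨T.parent_mem v i hv, fun w hw hwv => ?_⟩
    have h := hk w hw (hwv.trans (List.prefix_append v [i]))
    have h1 := hwv.length_le
    rw [h] at h1
    simp at h1
  sibling_mem := by
    rintro v i j hij ⟨hv, hk⟩
    refine ⟨T.sibling_mem v i j hij hv, fun w hw hwv => ?_⟩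
    rcases List.prefix_concat_iff.1 hwv with h | h
    · exact h
    · have h2 := hk w hw (h.trans (List.prefix_append v [i]))
      have h1 := h.length_le
      rw [h2] at h1
      simp at h1
  rootLabel := T.rootLabel
  edgeLabel := T.edgeLabel

/-- The largest label of the tree, as a supremum in the extended reals. -/
noncomputable def maxLabel (T : LabelledTree) : EReal :=
  ⨆ v ∈ T.nodes, (T.label v : EReal)

end LabelledTree

/-- The labelled tree with root label `x` in which the node `v` has exactly `N v` children
`v ++ [0], …, v ++ [N v - 1]`, and in which the edge above the node `v` has label `ξ v`. -/
def treeOf (x : ℝ) (N : List ℕ → ℕ) (ξ : List ℕ → ℝ) : LabelledTree where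
  nodes := {v | ∀ (k : ℕ) (hk : k < v.length), v[k] < N (v.take k)}
  root_mem := by intro k hk; simp at hk
  parent_mem := by
    intro v i h k hk
    have h1 := h k (by simp; omega)
    rwa [List.getElem_append_left hk, List.take_append_of_le_length hk.le] at h1
  sibling_mem := by
    intro v i j hij h k hk
    have hk' : k < v.length + 1 := by simpa using hk
    have h1 := h k (by simpa using hk')
    rw [List.take_append_of_le_length (by omega)] at h1 ⊢
    rcases Nat.lt_succ_iff_lt_or_eq.1 hk' with h2 | h2
    · rw [List.getElem_append_left h2] at h1 ⊢
      exact h1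
    · subst h2
      simp at h1 ⊢
      omega
  rootLabel := x
  edgeLabel := ξ

/-! Write A for `walkOp q j` and μ for the mean step. If p(x) is the probability that the tree with
root label x reaches a given level, then a geometric number of independent subtrees gives 1 - p = ∑
2^{-(n+1)} (1 - Ap)^n = 1/(1 + Ap), that is p = Ap/(1 + Ap), below the level and outside the killed
region (`reachProb_eq`). Since t/(1+t) is nondecreasing and 1-Lipschitz on [0,∞), solutions can be
compared by the linear maximum principle for A. Steps are at most 1, so the upper end of an interval
is never jumped over.

Without killing, the probability f(x) of reaching 0 from x < 0 behaves like a solution of μ f' = f²,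
whence n f(-n) → μ; explicit sub- and supersolutions of the form a/(b - x) prove this
(`tendsto_mul_apply_neg`).

With killing on (-∞, 0], the probability of reaching a distant level m is so small near 0 that the
nonlinear term is negligible there: it is nearly harmonic, hence nearly f(-m) W(x)/W(∞), with W the
scale function normalised by W(1) = 1. Here W(∞) = q 0/μ (`tendsto_scaleFn`), so at x = 1 the limit
is μ · μ/q 0 (`tendsto_mul_killed`). -/

/-! ### The transition operator and its maximum principles -/

/-- The weights `q k` are the probabilities of the steps `1 - k`, `0 ≤ k ≤ j + 1`, of a random walk
on `ℤ` with mean step `μ > 0`. -/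
structure IsStepLaw (q : ℕ → ℝ) (j : ℕ) (μ : ℝ) : Prop where
  nonneg : ∀ k, 0 ≤ q k
  sum_eq_one : ∑ k ∈ Finset.range (j + 2), q k = 1
  mean_eq : ∑ k ∈ Finset.range (j + 2), q k * (1 - (k : ℝ)) = μ
  mean_pos : 0 < μ

/-- The transition operator of the random walk with step weights `q`. -/
def walkOp (q : ℕ → ℝ) (j : ℕ) (f : ℤ → ℝ) (x : ℤ) : ℝ :=
  ∑ k ∈ Finset.range (j + 2), q k * f (x + 1 - k)

namespace IsStepLaw

variable {q : ℕ → ℝ} {j : ℕ} {μ : ℝ}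

lemma walkOp_const (hq : IsStepLaw q j μ) (c : ℝ) (x : ℤ) : walkOp q j (fun _ => c) x = c := by
  simp [walkOp, ← Finset.sum_mul, hq.sum_eq_one]

lemma walkOp_sub (f g : ℤ → ℝ) (x : ℤ) :
    walkOp q j (fun y => f y - g y) x = walkOp q j f x - walkOp q j g x := by
  simp [walkOp, mul_sub, Finset.sum_sub_distrib]

lemma walkOp_const_mul (c : ℝ) (f : ℤ → ℝ) (x : ℤ) :
    walkOp q j (fun y => c * f y) x = c * walkOp q j f x := by
  simp only [walkOp, Finset.mul_sum]
  exact Finset.sum_congr rfl fun _ _ => by ring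

lemma walkOp_shift (f : ℤ → ℝ) (m x : ℤ) :
    walkOp q j (fun y => f (y - m)) x = walkOp q j f (x - m) := by
  refine Finset.sum_congr rfl fun k _ => ?_
  rw [show x - m + 1 - (k : ℤ) = x + 1 - k - m by ring]

lemma walkOp_mono (hq : IsStepLaw q j μ) {f g : ℤ → ℝ} {x : ℤ} (h : ∀ y ≤ x + 1, f y ≤ g y) :
    walkOp q j f x ≤ walkOp q j g x :=
  Finset.sum_le_sum fun k _ => mul_le_mul_of_nonneg_left (h _ (by omega)) (hq.nonneg k)

lemma walkOp_nonneg (hq : IsStepLaw q j μ) {f : ℤ → ℝ} (h : ∀ y, 0 ≤ f y) (x : ℤ) :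
    0 ≤ walkOp q j f x :=
  Finset.sum_nonneg fun k _ => mul_nonneg (hq.nonneg k) (h _)

lemma pos_zero (hq : IsStepLaw q j μ) : 0 < q 0 := by
  have h := hq.mean_pos
  rw [← hq.mean_eq, Finset.sum_range_succ'] at h
  have h2 : ∑ k ∈ Finset.range (j + 1), q (k + 1) * (1 - ((k + 1 : ℕ) : ℝ)) ≤ 0 := by
    refine Finset.sum_nonpos fun k _ => mul_nonpos_of_nonneg_of_nonpos (hq.nonneg _) ?_
    push_cast
    linarith [k.cast_nonneg (α := ℝ)]
  simp only [Nat.cast_zero, sub_zero, mul_one] at h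
  linarith

lemma tendsto_walkOp (hq : IsStepLaw q j μ) {f : ℤ → ℝ} {α : ℝ} (h : Tendsto f atBot (𝓝 α)) :
    Tendsto (walkOp q j f) atBot (𝓝 α) := by
  have h1 : Tendsto (walkOp q j f) atBot (𝓝 (∑ k ∈ Finset.range (j + 2), q k * α)) := by
    refine tendsto_finsetSum _ fun k _ => (h.comp ?_).const_mul _
    simp_rw [add_sub_assoc]
    exact tendsto_atBot_add_const_right _ _ tendsto_id
  rwa [← Finset.sum_mul, hq.sum_eq_one, one_mul] at h1

/-- The discrete maximum principle on `(K, L)`; as the steps are at most `1`, only the values on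
`(-∞, K]` and at `L` serve as boundary values. -/
lemma maximum_principle (hq : IsStepLaw q j μ) {D : ℤ → ℝ} {K L : ℤ} (hK : ∀ x ≤ K, D x ≤ 0)
    (hL : D L ≤ 0) (hD : ∀ x, K < x → x < L → 0 < D x → D x ≤ walkOp q j D x) :
    ∀ x ≤ L, D x ≤ 0 := by
  by_contra! hcon
  obtain ⟨x₀, hx₀, hpos⟩ := hcon
  have hx₀' : x₀ ∈ Finset.Icc K L := Finset.mem_Icc.2
    ⟨by by_contra! h; exact absurd (hK x₀ h.le) hpos.not_ge, hx₀⟩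
  obtain ⟨x₁, hx₁, hmax⟩ := Finset.exists_max_image (Finset.Icc K L) D ⟨x₀, hx₀'⟩
  have hM : 0 < D x₁ := hpos.trans_le (hmax _ hx₀')
  have hle : ∀ y ≤ L, D y ≤ D x₁ := fun y hy => by
    rcases le_total y K with h | h
    · exact (hK y h).trans hM.le
    · exact hmax y (Finset.mem_Icc.2 ⟨h, hy⟩)
  -- As `q 0 > 0`, a positive maximum at a point forces the same value one step to the right, and so
  -- on up to L, where D is nonpositive.
  have hprop : ∀ n : ℕ, x₁ + n ≤ L → D (x₁ + n) = D x₁ := by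
    intro n
    induction n with
    | zero => simp
    | succ n ih =>
      intro hn
      push_cast at hn
      have ih' := ih (by omega)
      have h1 := hD (x₁ + n) (by have := (Finset.mem_Icc.1 hx₁).1
                                 by_contra! h
                                 exact absurd (hK _ h) (by rw [ih']; exact hM.not_ge))
        (by omega) (by rw [ih']; exact hM)
      have h2 : walkOp q j D (x₁ + n) ≤ q 0 * D (x₁ + n + 1) + (1 - q 0) * D x₁ := by
        rw [← hq.sum_eq_one, walkOp, Finset.sum_range_succ', Finset.sum_range_succ' q,
          add_sub_cancel_right, Finset.sum_mul, add_comm]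
        simp only [Nat.cast_zero, sub_zero]
        refine add_le_add le_rfl (Finset.sum_le_sum fun k _ => ?_)
        exact mul_le_mul_of_nonneg_left (hle _ (by push_cast; omega)) (hq.nonneg _)
      rw [ih'] at h1
      have h3 := hle (x₁ + n + 1) (by omega)
      have h4 : q 0 * D x₁ ≤ q 0 * D (x₁ + n + 1) := by linarith
      have h5 := le_of_mul_le_mul_left h4 hq.pos_zero
      push_cast
      rw [← add_assoc]
      linarith
  have := hprop (L - x₁).toNat (by have := (Finset.mem_Icc.1 hx₁).2; omega)
  rw [Int.toNat_of_nonneg (by have := (Finset.mem_Icc.1 hx₁).2; omega)] at this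
  simp only [add_sub_cancel] at this
  linarith

/-- The maximum principle on `(-∞, L)` for functions vanishing at `-∞`. -/
lemma maximum_principle_atBot (hq : IsStepLaw q j μ) {D : ℤ → ℝ} {L : ℤ}
    (hbot : Tendsto D atBot (𝓝 0)) (hL : D L ≤ 0)
    (hD : ∀ x < L, 0 < D x → D x ≤ walkOp q j D x) : ∀ x ≤ L, D x ≤ 0 := by
  intro x hx
  refine le_of_forall_pos_le_add fun ε hε => ?_
  obtain ⟨K, hK⟩ := eventually_atBot.1 (hbot.eventually (gt_mem_nhds hε))
  -- Subtracting ε makes the function nonpositive far to the left.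
  have := hq.maximum_principle (D := fun y => D y - ε) (K := K) (L := L)
    (fun y hy => by linarith [hK y hy]) (by linarith) (fun y _ hy hpos => by
      rw [walkOp_sub, hq.walkOp_const]
      linarith [hD y hy (by linarith)]) x hx
  linarith

end IsStepLaw

/-! ### Reaching 0 without killing: n f(-n) → μ -/

lemma div_one_add_mono {s t : ℝ} (hs : 0 ≤ s) (hst : s ≤ t) : s / (1 + s) ≤ t / (1 + t) := by
  rw [div_le_div_iff₀ (by linarith) (by linarith)]
  nlinarith

lemma div_one_add_sub_le {s t : ℝ} (hs : 0 ≤ s) (hst : s ≤ t) :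
    t / (1 + t) - s / (1 + s) ≤ t - s := by
  rw [div_sub_div _ _ (by linarith) (by linarith), div_le_iff₀ (by nlinarith)]
  have h1 : 0 ≤ (t - s) * (t + s + t * s) := by
    have : 0 ≤ t * s := mul_nonneg (hs.trans hst) hs
    exact mul_nonneg (by linarith) (by linarith)
  nlinarith

/-- Passage from the nonlinear equation to the linear one: wherever a subsolution a exceeds a
supersolution b, their difference satisfies the inequality required by the maximum principle. -/
lemma sub_le_of_div_one_add {a b s t : ℝ} (hs : 0 ≤ s) (ht : 0 ≤ t) (ha : a ≤ t / (1 + t))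
    (hb : s / (1 + s) ≤ b) (hab : 0 < a - b) : a - b ≤ t - s := by
  rcases le_total s t with h | h
  · linarith [div_one_add_sub_le hs h]
  · linarith [div_one_add_mono ht h]

namespace IsStepLaw

variable {q : ℕ → ℝ} {j : ℕ} {μ : ℝ} {f : ℤ → ℝ}

/-- The monotone limit α satisfies α = α/(1 + α), hence α² = 0. -/
lemma tendsto_atBot_zero (hq : IsStepLaw q j μ) (h0 : ∀ x, 0 ≤ f x) (hmono : Monotone f)
    (hf : ∀ x < 0, f x = walkOp q j f x / (1 + walkOp q j f x)) : Tendsto f atBot (𝓝 0) := by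
  have h1 : Tendsto f atBot (𝓝 (⨅ x, f x)) :=
    tendsto_atBot_ciInf hmono ⟨0, by rintro _ ⟨x, rfl⟩; exact h0 x⟩
  set α := ⨅ x, f x
  have hα : 0 ≤ α := ge_of_tendsto' h1 h0
  have h2 := hq.tendsto_walkOp h1
  have h3 : Tendsto f atBot (𝓝 (α / (1 + α))) := by
    refine (h2.div (h2.const_add 1) (by linarith)).congr' ?_
    filter_upwards [eventually_lt_atBot 0] with x hx using (hf x hx).symm
  have h4 := tendsto_nhds_unique h1 h3
  rw [eq_div_iff (by linarith)] at h4
  have : α * α = 0 := by linarith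
  rwa [mul_self_eq_zero.1 this] at h1

/-- The function μ/(μ - x) is a subsolution with value 1 at 0. One step of the walk turns the mean
of μ - y into -x, so Jensen's inequality suffices. -/
lemma lower_bound (hq : IsStepLaw q j μ) (h0 : ∀ x, 0 ≤ f x) (hmono : Monotone f)
    (hone : f 0 = 1) (hf : ∀ x < 0, f x = walkOp q j f x / (1 + walkOp q j f x)) :
    ∀ x ≤ 0, μ / (μ - x) ≤ f x := by
  have hμ := hq.mean_pos
  have hbot : Tendsto (fun x : ℤ => μ / (μ - x)) atBot (𝓝 0) := by
    refine Tendsto.div_atTop tendsto_const_nhds ?_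
    refine tendsto_atTop_add_const_left _ _ ?_
    exact tendsto_neg_atBot_atTop.comp (tendsto_intCast_atBot_iff.2 tendsto_id)
  have := hq.maximum_principle_atBot (D := fun x : ℤ => μ / (μ - x) - f x) (L := 0)
    (by simpa using hbot.sub (hq.tendsto_atBot_zero h0 hmono hf))
    (by simp [hone, hμ.ne']) ?_
  · intro x hx
    linarith [this x hx]
  intro x hx hpos
  rw [walkOp_sub]
  have hx' : (x : ℝ) ≤ -1 := by exact_mod_cast (by omega : x ≤ -1)
  have key : μ / (-x) ≤ walkOp q j (fun y : ℤ => μ / (μ - y)) x := by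
    -- Jensen for t ↦ 1/t: the k-th summand is, up to the factor μ, the tangent line at t = -x
    -- evaluated at t = μ - (x + 1 - k), written as constant plus multiple of the step.
    have e : μ / (-x) = ∑ k ∈ Finset.range (j + 2),
        (q k * (μ * (2 / (-x) - (μ - x) / x ^ 2)) + q k * (1 - (k : ℝ)) * (μ / x ^ 2)) := by
      rw [Finset.sum_add_distrib, ← Finset.sum_mul, ← Finset.sum_mul, hq.sum_eq_one, hq.mean_eq]
      have : (x : ℝ) ≠ 0 := by linarith
      field_simp
      ring
    rw [e]
    refine Finset.sum_le_sum fun k _ => ?_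
    rw [mul_assoc, ← mul_add]
    refine mul_le_mul_of_nonneg_left ?_ (hq.nonneg k)
    have ht : 0 < μ - ((x + 1 - k : ℤ) : ℝ) := by
      push_cast
      linarith [k.cast_nonneg (α := ℝ)]
    have hx2 : (x : ℝ) ≠ 0 := by linarith
    set t := μ - ((x + 1 - k : ℤ) : ℝ) with htdef
    have e2 : μ * (2 / (-x) - (μ - x) / x ^ 2) + (1 - (k : ℝ)) * (μ / x ^ 2)
        = μ * ((-2 * x - t) / x ^ 2) := by
      rw [htdef]
      push_cast
      field_simp
      ring
    change _ ≤ μ / t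
    rw [e2, div_eq_mul_one_div μ]
    refine mul_le_mul_of_nonneg_left ?_ hμ.le
    rw [div_le_div_iff₀ (by positivity) ht]
    nlinarith [sq_nonneg (t + x)]
  refine sub_le_of_div_one_add (hq.walkOp_nonneg h0 x) ?_ ?_ (hf x hx).ge hpos
  · exact le_trans (div_nonneg hμ.le (by linarith)) key
  -- For s = μ/(-x), s/(1 + s) is exactly μ/(μ - x).
  · refine le_trans (le_of_eq ?_) (div_one_add_mono (div_nonneg hμ.le (by linarith)) key)
    rw [sub_eq_add_neg]
    have hn : 0 < -(x : ℝ) := by linarith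
    generalize -(x : ℝ) = n at hn
    field_simp
    ring

/-- Expansion of 1/(s - d) in the step d. The remainder d²/(s²(s - d)) is controlled by |d| ≤ j + 1
and by s - d ≥ s/2, which follows from d ≤ 1 ≤ s/2. -/
lemma walkOp_recip_le (hq : IsStepLaw q j μ) {c : ℝ} {x : ℤ} (hs : 2 ≤ c - x) :
    walkOp q j (fun y : ℤ => 1 / (c - y)) x
      ≤ 1 / (c - x) + μ / (c - x) ^ 2 + 2 * (j + 1) ^ 2 / (c - x) ^ 3 := by
  set s := c - (x : ℝ) with hsdef
  have e : 1 / s + μ / s ^ 2 + 2 * (j + 1) ^ 2 / s ^ 3 = ∑ k ∈ Finset.range (j + 2),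
      (q k * (1 / s + 2 * (j + 1) ^ 2 / s ^ 3) + q k * (1 - (k : ℝ)) * (1 / s ^ 2)) := by
    rw [Finset.sum_add_distrib, ← Finset.sum_mul, ← Finset.sum_mul, hq.sum_eq_one, hq.mean_eq]
    ring
  rw [e]
  refine Finset.sum_le_sum fun k hk => ?_
  rw [mul_assoc, ← mul_add]
  refine mul_le_mul_of_nonneg_left ?_ (hq.nonneg k)
  have hk1 : (k : ℝ) ≤ j + 1 := by
    have := Finset.mem_range.1 hk
    exact_mod_cast (by omega : k ≤ j + 1)
  have hk0 : (0 : ℝ) ≤ k := k.cast_nonneg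
  have e1 : c - ((x + 1 - k : ℤ) : ℝ) = s - (1 - k) := by rw [hsdef]; push_cast; ring
  simp only [e1]
  set d : ℝ := 1 - k
  have hd1 : d ≤ 1 := by simp only [d]; linarith
  have hd2 : d ^ 2 ≤ (j + 1) ^ 2 := by
    have hj : (0 : ℝ) ≤ j := j.cast_nonneg
    apply sq_le_sq'
    all_goals simp only [d]; linarith
  have hsd : s / 2 ≤ s - d := by linarith
  have hspos : 0 < s := by linarith
  have hne : s - d ≠ 0 := by linarith
  have e2 : 1 / (s - d) = 1 / s + d * (1 / s ^ 2) + d ^ 2 / (s ^ 2 * (s - d)) := by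
    field_simp
    ring
  have e3 : d ^ 2 / (s ^ 2 * (s - d)) ≤ (j + 1) ^ 2 / (s ^ 2 * (s / 2)) := by
    gcongr
  have e4 : ((j : ℝ) + 1) ^ 2 / (s ^ 2 * (s / 2)) = 2 * (j + 1) ^ 2 / s ^ 3 := by
    field_simp
  rw [e2]
  linarith

/-- For μ' > μ and c large, μ'/(c - x) is a supersolution: the gap μ' - μ absorbs the remainder of
the expansion. The shift by n₀ makes the inequality hold at x = 0. -/
lemma upper_bound (hq : IsStepLaw q j μ) (h0 : ∀ x, 0 ≤ f x) (hmono : Monotone f)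
    (hf : ∀ x < 0, f x = walkOp q j f x / (1 + walkOp q j f x)) {μ' : ℝ} (hμ' : μ < μ') :
    ∃ (n₀ : ℕ) (c : ℝ), 0 < c ∧ ∀ x ≤ (0 : ℤ), f (x - n₀) ≤ μ' / (c - x) := by
  have hμ := hq.mean_pos
  have hlim := hq.tendsto_atBot_zero h0 hmono hf
  -- The bound 2 permits `walkOp_recip_le`; the other one makes 2(j+1)²/s at most μ' - μ for all s ≥
  -- c.
  set c : ℝ := max 2 (2 * (j + 1) ^ 2 / (μ' - μ)) with hc
  have hc2 : 2 ≤ c := le_max_left _ _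
  have hc3 : 2 * (j + 1) ^ 2 / (μ' - μ) ≤ c := le_max_right _ _
  rw [div_le_iff₀ (by linarith)] at hc3
  obtain ⟨K, hK⟩ := eventually_atBot.1
    (hlim.eventually (gt_mem_nhds (show 0 < μ' / c from div_pos (by linarith) (by linarith))))
  refine ⟨(-K).toNat, c, by linarith, ?_⟩
  set n₀ := (-K).toNat
  have hlim2 : Tendsto (fun x : ℤ => f (x - n₀)) atBot (𝓝 0) := by
    refine hlim.comp ?_
    simp_rw [sub_eq_add_neg]
    exact tendsto_atBot_add_const_right _ _ tendsto_id
  have hbot : Tendsto (fun x : ℤ => μ' * (1 / (c - x))) atBot (𝓝 0) := by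
    rw [← mul_zero μ']
    refine Tendsto.const_mul _ (Tendsto.div_atTop tendsto_const_nhds ?_)
    refine tendsto_atTop_add_const_left _ _ ?_
    exact tendsto_neg_atBot_atTop.comp (tendsto_intCast_atBot_iff.2 tendsto_id)
  have := hq.maximum_principle_atBot (D := fun x : ℤ => f (x - n₀) - μ' * (1 / (c - x))) (L := 0)
    (by simpa using hlim2.sub hbot) ?_ ?_
  · intro x hx
    have := this x hx
    rw [mul_one_div] at this
    linarith
  · have := hK (0 - n₀) (by omega)
    simp only [Int.cast_zero, sub_zero, mul_one_div]
    linarith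
  intro x hx hpos
  rw [walkOp_sub, walkOp_const_mul, walkOp_shift (f := f)]
  have hx' : (x : ℝ) ≤ 0 := by exact_mod_cast hx.le
  have hs : 2 ≤ c - x := by linarith
  have hw0 : 0 ≤ walkOp q j (fun y : ℤ => 1 / (c - y)) x := by
    refine Finset.sum_nonneg fun k _ => mul_nonneg (hq.nonneg k) ?_
    refine one_div_nonneg.2 ?_
    push_cast
    linarith [k.cast_nonneg (α := ℝ)]
  refine sub_le_of_div_one_add (mul_nonneg (by linarith) hw0) (hq.walkOp_nonneg h0 _)
    (hf _ (by omega)).le ?_ hpos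
  have key := mul_le_mul_of_nonneg_left (hq.walkOp_recip_le hs) (show 0 ≤ μ' by linarith)
  refine (div_one_add_mono (mul_nonneg (by linarith) hw0) key).trans ?_
  set s := c - (x : ℝ)
  have hspos : 0 < s := by linarith
  set y := μ / s + 2 * (j + 1) ^ 2 / s ^ 2 with hy
  have hy0 : 0 ≤ y := by positivity
  have hys : y ≤ μ' / s := by
    have : y = (μ + 2 * (j + 1) ^ 2 / s) / s := by rw [hy]; field_simp
    rw [this]
    gcongr
    have : 2 * ((j : ℝ) + 1) ^ 2 / s ≤ μ' - μ := by
      rw [div_le_iff₀ hspos]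
      have : c ≤ s := by simp only [s]; linarith
      nlinarith
    linarith
  -- With G = μ'/s the claim becomes G(1 + y)/(1 + G(1 + y)) ≤ G, which follows from y ≤ G.
  have e : μ' * (1 / s + μ / s ^ 2 + 2 * (j + 1) ^ 2 / s ^ 3) = μ' / s * (1 + y) := by
    rw [hy]
    field_simp
    ring
  rw [e, mul_one_div]
  have hG : 0 ≤ μ' / s := div_nonneg (by linarith) hspos.le
  generalize μ' / s = G at *
  rw [div_le_iff₀ (by nlinarith)]
  nlinarith [mul_nonneg hG hy0, mul_nonneg hG (mul_nonneg hG hy0), mul_nonneg hG (sub_nonneg.2 hys)]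

lemma tendsto_mul_apply_neg (hq : IsStepLaw q j μ) (h0 : ∀ x, 0 ≤ f x) (hmono : Monotone f)
    (hone : f 0 = 1) (hf : ∀ x < 0, f x = walkOp q j f x / (1 + walkOp q j f x)) :
    Tendsto (fun n : ℕ => (n : ℝ) * f (-n)) atTop (𝓝 μ) := by
  have hμ := hq.mean_pos
  have hratio : ∀ a b : ℝ, Tendsto (fun n : ℕ => (n : ℝ) * (a / (b + n))) atTop (𝓝 a) := by
    intro a b
    have h := (tendsto_natCast_div_add_atTop b).const_mul a
    rw [mul_one] at h
    refine h.congr fun n => ?_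
    rw [add_comm]
    ring
  refine tendsto_order.2 ⟨fun a ha => ?_, fun b hb => ?_⟩
  · filter_upwards [(hratio μ μ).eventually (lt_mem_nhds ha)] with n hn
    have := hq.lower_bound h0 hmono hone hf (-n) (by omega)
    push_cast at this
    rw [sub_neg_eq_add] at this
    exact hn.trans_le (mul_le_mul_of_nonneg_left this n.cast_nonneg)
  · obtain ⟨μ', h1, h2⟩ := exists_between hb
    obtain ⟨n₀, c, hc, hbd⟩ := hq.upper_bound h0 hmono hf h1
    filter_upwards [(hratio μ' (c - n₀)).eventually (gt_mem_nhds h2), eventually_ge_atTop n₀]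
      with n hn hn'
    have := hbd (n₀ - n) (by omega)
    rw [show (n₀ : ℤ) - n - n₀ = -n by ring] at this
    push_cast at this
    rw [show c - ((n₀ : ℝ) - n) = c - n₀ + n by ring] at this
    exact (mul_le_mul_of_nonneg_left this n.cast_nonneg).trans_lt hn

end IsStepLaw

/-! ### The scale function and its limit q 0/μ -/

/-- The scale function of the walk killed on `(-∞, 0]`, on the nonnegative integers. -/
noncomputable def scaleSeq (q : ℕ → ℝ) (j : ℕ) : ℕ → ℝ
  | 0 => 0
  | 1 => 1
  | n + 2 =>
    (scaleSeq q j (n + 1) - ∑ k ∈ Finset.range (j + 1), q (k + 1) * scaleSeq q j (n + 1 - k)) / q 0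
termination_by n => n
decreasing_by all_goals omega

/-- The scale function of the walk killed on `(-∞, 0]`: it vanishes there, is harmonic on the
positive integers and equals `1` at `1`. -/
noncomputable def scaleFn (q : ℕ → ℝ) (j : ℕ) (x : ℤ) : ℝ := scaleSeq q j x.toNat

/-- The partial sums of the scale function. -/
noncomputable def scaleSum (q : ℕ → ℝ) (j : ℕ) (x : ℤ) : ℝ :=
  ∑ i ∈ Finset.range (x.toNat + 1), scaleSeq q j i

section Scale

variable {q : ℕ → ℝ} {j : ℕ} {μ : ℝ}

lemma scaleSeq_zero : scaleSeq q j 0 = 0 := by rw [scaleSeq]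

lemma scaleSeq_one : scaleSeq q j 1 = 1 := by rw [scaleSeq]

lemma scaleFn_of_nonpos {x : ℤ} (hx : x ≤ 0) : scaleFn q j x = 0 := by
  rw [scaleFn, Int.toNat_of_nonpos hx, scaleSeq_zero]

lemma scaleFn_one : scaleFn q j 1 = 1 := by
  rw [scaleFn, Int.toNat_one, scaleSeq_one]

lemma scaleSum_succ (x : ℤ) : scaleSum q j (x + 1) = scaleSum q j x + scaleFn q j (x + 1) := by
  rcases lt_or_ge x 0 with h | h
  · rw [scaleFn_of_nonpos (by omega), scaleSum, scaleSum, Int.toNat_of_nonpos h.le,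
      Int.toNat_of_nonpos (by omega), add_zero]
  · rw [scaleSum, scaleSum, scaleFn, show (x + 1).toNat = x.toNat + 1 by omega,
      Finset.sum_range_succ _ (x.toNat + 1)]

end Scale

namespace IsStepLaw

variable {q : ℕ → ℝ} {j : ℕ} {μ : ℝ}

lemma walkOp_scaleFn (hq : IsStepLaw q j μ) {x : ℤ} (hx : 1 ≤ x) :
    walkOp q j (scaleFn q j) x = scaleFn q j x := by
  obtain ⟨n, rfl⟩ : ∃ n : ℕ, x = n + 1 := ⟨(x - 1).toNat, by omega⟩
  rw [walkOp, Finset.sum_range_succ']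
  have h1 : scaleFn q j ((n : ℤ) + 1 + 1 - (0 : ℕ)) = scaleSeq q j (n + 2) := by
    rw [scaleFn]
    congr 1
  -- Truncated subtraction is harmless: jumps below 0 are sent to 0, where the sequence vanishes as
  -- well.
  have h2 : ∀ k : ℕ, scaleFn q j ((n : ℤ) + 1 + 1 - (k + 1 : ℕ)) = scaleSeq q j (n + 1 - k) := by
    intro k
    rw [scaleFn]
    congr 1
    omega
  have h3 : scaleFn q j ((n : ℤ) + 1) = scaleSeq q j (n + 1) := rfl
  simp_rw [h1, h2, h3]
  rw [scaleSeq, mul_div_cancel₀ _ hq.pos_zero.ne']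
  ring

/-- By harmonicity the value at n + 1 is an average of the value at n + 2 and of earlier values,
which by induction do not exceed it. -/
lemma scaleSeq_mono (hq : IsStepLaw q j μ) : Monotone (scaleSeq q j) := by
  have key : ∀ n, ∀ i ≤ n, scaleSeq q j i ≤ scaleSeq q j n := by
    intro n
    induction n with
    | zero => intro i hi; rw [Nat.le_zero.1 hi]
    | succ n ih =>
      have hstep : scaleSeq q j n ≤ scaleSeq q j (n + 1) := by
        rcases n with _ | n
        · rw [scaleSeq_zero, scaleSeq_one]; exact zero_le_one
        · rw [scaleSeq.eq_3, le_div_iff₀ hq.pos_zero]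
          have h1 : ∑ k ∈ Finset.range (j + 1), q (k + 1) * scaleSeq q j (n + 1 - k)
              ≤ (1 - q 0) * scaleSeq q j (n + 1) := by
            rw [← hq.sum_eq_one, Finset.sum_range_succ' q, add_sub_cancel_right, Finset.sum_mul]
            exact Finset.sum_le_sum fun k _ =>
              mul_le_mul_of_nonneg_left (ih _ (by omega)) (hq.nonneg _)
          linarith
      intro i hi
      rcases Nat.lt_or_eq_of_le hi with h | h
      · exact (ih i (by omega)).trans hstep
      · rw [h]
  exact fun a b hab => key b a hab

lemma scaleFn_mono (hq : IsStepLaw q j μ) : Monotone (scaleFn q j) :=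
  fun _ _ h => hq.scaleSeq_mono (Int.toNat_le_toNat h)

lemma scaleFn_pos (hq : IsStepLaw q j μ) {x : ℤ} (hx : 1 ≤ x) : 0 < scaleFn q j x :=
  zero_lt_one.trans_le (scaleFn_one.symm.trans_le (hq.scaleFn_mono hx))

/-- The left side is V - AV at n, for V the partial sums of W. Its increments are W - AW = 0 at
positive integers, so it keeps its value at 0, which is -q 0 · W(1). This conserved quantity
identifies W(∞). -/
lemma sum_scaleSum (hq : IsStepLaw q j μ) (n : ℕ) :
    ∑ k ∈ Finset.range (j + 2), q k * (scaleSum q j n - scaleSum q j (n + 1 - k)) = - q 0 := by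
  induction n with
  | zero =>
    have h0 : ∀ x : ℤ, x ≤ 0 → scaleSum q j x = 0 := fun x hx => by
      simp [scaleSum, Int.toNat_of_nonpos hx, scaleSeq_zero]
    rw [Finset.sum_range_succ', Finset.sum_eq_zero]
    · have := scaleSum_succ (q := q) (j := j) 0
      rw [zero_add, h0 0 le_rfl, scaleFn_one, zero_add] at this
      simp [this, h0 0 le_rfl]
    · intro k _
      rw [h0 _ (by simp), h0 _ (by push_cast; omega)]
      simp
  | succ n ih =>
    rw [← ih, ← sub_eq_zero, ← Finset.sum_sub_distrib]
    have h := hq.walkOp_scaleFn (x := (n : ℤ) + 1) (by omega)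
    rw [← sub_eq_zero, ← neg_eq_zero, neg_sub, walkOp,
      ← one_mul (scaleFn q j ((n : ℤ) + 1)), ← hq.sum_eq_one, Finset.sum_mul,
      ← Finset.sum_sub_distrib] at h
    rw [← h]
    refine Finset.sum_congr rfl fun k _ => ?_
    have e := scaleSum_succ (q := q) (j := j) (n + 1 - k)
    rw [show (n : ℤ) + 1 - k + 1 = n + 1 + 1 - k by ring] at e
    push_cast
    rw [e, scaleSum_succ]
    ring

/-- For k ≥ 1 the difference is a sum of k - 1 values of W, each at most W(n + 1); for k = 0 it
equals -W(n + 1). -/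
lemma scaleSum_sub_le (hq : IsStepLaw q j μ) (n k : ℕ) :
    scaleSum q j n - scaleSum q j (n + 1 - k) ≤ ((k : ℝ) - 1) * scaleFn q j (n + 1) := by
  induction k with
  | zero =>
    have := scaleSum_succ (q := q) (j := j) n
    simp only [Nat.cast_zero, sub_zero]
    linarith
  | succ k ih =>
    have e := scaleSum_succ (q := q) (j := j) ((n : ℤ) + 1 - (k + 1 : ℕ))
    rw [show (n : ℤ) + 1 - (k + 1 : ℕ) + 1 = n + 1 - k by push_cast; ring] at e
    have := hq.scaleFn_mono (show (n : ℤ) + 1 - k ≤ n + 1 by omega)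
    push_cast at *
    linarith

lemma sum_mul_sub_one (hq : IsStepLaw q j μ) (w : ℝ) :
    ∑ k ∈ Finset.range (j + 2), q k * (((k : ℝ) - 1) * w) = - μ * w := by
  rw [← hq.mean_eq, ← Finset.sum_neg_distrib, Finset.sum_mul]
  exact Finset.sum_congr rfl fun k _ => by ring

lemma scaleFn_le (hq : IsStepLaw q j μ) (n : ℕ) : scaleFn q j (n + 1) ≤ q 0 / μ := by
  rw [le_div_iff₀ hq.mean_pos]
  have h := Finset.sum_le_sum (s := Finset.range (j + 2)) fun k _ =>
    mul_le_mul_of_nonneg_left (hq.scaleSum_sub_le n k) (hq.nonneg k)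
  rw [hq.sum_scaleSum, hq.sum_mul_sub_one] at h
  linarith

/-- W is monotone and bounded. In the limit w, the difference of partial sums in `sum_scaleSum`
becomes (k - 1)w, so that -q 0 = -μ w. -/
lemma tendsto_scaleFn (hq : IsStepLaw q j μ) :
    Tendsto (fun n : ℕ => scaleFn q j n) atTop (𝓝 (q 0 / μ)) := by
  have hmono : Monotone fun n : ℕ => scaleFn q j n :=
    fun a b hab => hq.scaleFn_mono (by exact_mod_cast hab)
  have hbdd : BddAbove (Set.range fun n : ℕ => scaleFn q j n) := by
    refine ⟨q 0 / μ, ?_⟩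
    rintro _ ⟨n, rfl⟩
    exact (hq.scaleFn_mono (by simp)).trans (hq.scaleFn_le n)
  have hlim := tendsto_atTop_ciSup hmono hbdd
  set w := ⨆ n : ℕ, scaleFn q j n
  have hlim' : ∀ c : ℤ, Tendsto (fun n : ℕ => scaleFn q j (n + c)) atTop (𝓝 w) := by
    intro c
    have h : Tendsto (fun n : ℕ => ((n : ℤ) + c).toNat) atTop atTop := by
      refine tendsto_atTop.2 fun b => ?_
      filter_upwards [eventually_ge_atTop (b + c.natAbs)] with n hn
      omega
    refine (hlim.comp h).congr fun n => ?_
    simp [scaleFn]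
  have hdiff : ∀ k : ℕ, Tendsto (fun n : ℕ => scaleSum q j n - scaleSum q j (n + 1 - k)) atTop
      (𝓝 (((k : ℝ) - 1) * w)) := by
    intro k
    induction k with
    | zero =>
      have h := (hlim' 1).neg
      simp only [Nat.cast_zero, zero_sub, neg_mul, one_mul, sub_zero]
      refine h.congr fun n => ?_
      rw [scaleSum_succ]
      ring
    | succ k ih =>
      have h := ih.add (hlim' (1 - k))
      rw [show ((k : ℝ) - 1) * w + w = ((k + 1 : ℕ) - 1) * w by push_cast; ring] at h
      refine h.congr fun n => ?_
      have e := scaleSum_succ (q := q) (j := j) ((n : ℤ) + 1 - (k + 1 : ℕ))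
      rw [show (n : ℤ) + 1 - (k + 1 : ℕ) + 1 = n + 1 - k by push_cast; ring] at e
      rw [show (n : ℤ) + (1 - k) = n + 1 - k by ring]
      linarith
  have hsum := tendsto_finsetSum (Finset.range (j + 2)) fun k _ => (hdiff k).const_mul (q k)
  simp_rw [hq.sum_scaleSum, hq.sum_mul_sub_one] at hsum
  have := tendsto_nhds_unique hsum tendsto_const_nhds
  rwa [show q 0 / μ = w by rw [div_eq_iff hq.mean_pos.ne']; linarith]

/-! ### Comparison of the killed and the unkilled walk -/

/-- Asymptotics of the probability that the killed branching walk started at `1` reaches the level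
`m`: `f x` is the probability that the branching walk without killing started at `x` reaches `0`,
and `h m x` that of the walk killed on `(-∞, 0]` and started at `x` reaching `m`. -/
theorem tendsto_mul_killed (hq : IsStepLaw q j μ) {f : ℤ → ℝ} {h : ℕ → ℤ → ℝ}
    (h0 : ∀ x, 0 ≤ f x) (hmono : Monotone f) (hone : f 0 = 1)
    (hf : ∀ x < 0, f x = walkOp q j f x / (1 + walkOp q j f x))
    (hh0 : ∀ m x, 0 ≤ h m x) (hhf : ∀ m x, h m x ≤ f (x - m))
    (hhz : ∀ m, 1 ≤ m → ∀ x ≤ 0, h m x = 0) (hhone : ∀ m : ℕ, h m m = 1)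
    (hh : ∀ (m : ℕ) (x : ℤ), 1 ≤ x → x < m →
      h m x = walkOp q j (h m) x / (1 + walkOp q j (h m) x)) :
    Tendsto (fun m : ℕ => (m : ℝ) * h m 1) atTop (𝓝 (μ ^ 2 / q 0)) := by
  have hμ := hq.mean_pos
  have hq0 := hq.pos_zero
  have hasymp := hq.tendsto_mul_apply_neg h0 hmono hone hf
  have hlow : ∀ m : ℕ, 1 ≤ m → f (-m) / scaleFn q j m ≤ h m 1 := by
    intro m hm
    have hWm := hq.scaleFn_pos (show 1 ≤ (m : ℤ) by exact_mod_cast hm)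
    -- On (0, m) the loss f(· - m) - h m is subharmonic, by the Lipschitz bound. It is compared with
    -- the harmonic function f(-m)(1 - W/W(m)), which equals f(-m) on (-∞, 0] and 0 at m.
    have := hq.maximum_principle
      (D := fun x => (f (x - m) - h m x) - (f (-m) - f (-m) / scaleFn q j m * scaleFn q j x))
      (K := 0) (L := m) ?_ ?_ ?_ 1 (by exact_mod_cast hm)
    · rw [scaleFn_one] at this
      have := hmono (show -(m : ℤ) ≤ 1 - m by omega)
      linarith
    · intro x hx
      rw [hhz m hm x hx, scaleFn_of_nonpos hx]
      have := hmono (show x - m ≤ -(m : ℤ) by omega)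
      linarith
    · rw [sub_self, hone, hhone, div_mul_cancel₀ _ hWm.ne']
      simp
    · intro x hx hxm _
      rw [walkOp_sub, walkOp_sub (fun y => f (y - m)), walkOp_sub (fun _ => f (-m)),
        hq.walkOp_const, walkOp_const_mul, hq.walkOp_scaleFn (by omega), walkOp_shift (f := f),
        hf (x - m) (by omega), hh m x (by omega) hxm]
      have h1 := hq.walkOp_nonneg (hh0 m) x
      have h2 := hq.walkOp_mono (x := x) fun y _ => hhf m y
      rw [walkOp_shift (f := f)] at h2
      linarith [div_one_add_sub_le h1 h2]
  have hup : ∀ L m : ℕ, 1 ≤ L → L ≤ m → h m 1 ≤ f (-(m - L : ℕ)) / scaleFn q j L := by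
    intro L m hL hLm
    have hWL := hq.scaleFn_pos (show 1 ≤ (L : ℤ) by exact_mod_cast hL)
    -- Dropping the denominator, h m is subharmonic on (0, L), so the multiple of W with the same
    -- value at L dominates it.
    have := hq.maximum_principle (D := fun x => h m x - h m L / scaleFn q j L * scaleFn q j x)
      (K := 0) (L := L) ?_ ?_ ?_ 1 (by exact_mod_cast hL)
    · rw [scaleFn_one, mul_one] at this
      refine (sub_nonpos.1 this).trans ?_
      have e := hhf m L
      rw [show (L : ℤ) - m = -(m - L : ℕ) by omega] at e
      gcongr
    · intro x hx
      rw [hhz m (hL.trans hLm) x hx, scaleFn_of_nonpos hx]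
      simp
    · rw [div_mul_cancel₀ _ hWL.ne', sub_self]
    · intro x hx hxL _
      rw [walkOp_sub, walkOp_const_mul, hq.walkOp_scaleFn (by omega)]
      have h1 := hq.walkOp_nonneg (hh0 m) x
      have h2 := hh m x (by omega) (by omega)
      have h3 : h m x ≤ walkOp q j (h m) x := by
        rw [h2]
        exact div_le_self h1 (by linarith)
      linarith
  refine tendsto_order.2 ⟨fun a ha => ?_, fun b hb => ?_⟩
  · have hl := hasymp.div hq.tendsto_scaleFn (div_pos hq0 hμ).ne'
    rw [show μ / (q 0 / μ) = μ ^ 2 / q 0 by field_simp] at hl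
    filter_upwards [hl.eventually (lt_mem_nhds ha), eventually_ge_atTop 1] with m hm hm1
    refine hm.trans_le ?_
    simp only [Pi.div_apply]
    rw [mul_div_assoc]
    exact mul_le_mul_of_nonneg_left (hlow m hm1) m.cast_nonneg
  -- For fixed L the upper bound tends to μ/W(L) as m → ∞; L is chosen beforehand so that this is
  -- below b.
  · have hl : Tendsto (fun L : ℕ => μ / scaleFn q j L) atTop (𝓝 (μ ^ 2 / q 0)) := by
      have := (tendsto_const_nhds (x := μ)).div hq.tendsto_scaleFn (div_pos hq0 hμ).ne'
      rwa [show μ / (q 0 / μ) = μ ^ 2 / q 0 by field_simp] at this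
    obtain ⟨L, hLb, hL1⟩ := ((hl.eventually (gt_mem_nhds hb)).and (eventually_ge_atTop 1)).exists
    have hWL := hq.scaleFn_pos (show 1 ≤ (L : ℤ) by exact_mod_cast hL1)
    have hshift : Tendsto (fun m : ℕ => (m : ℝ) * (f (-(m - L : ℕ)) / scaleFn q j L)) atTop
        (𝓝 (μ / scaleFn q j L)) := by
      have h1 := hasymp.comp (tendsto_sub_atTop_nat L)
      have h2 : Tendsto (fun m : ℕ => (L : ℝ) * f (-(m - L : ℕ))) atTop (𝓝 ((L : ℝ) * 0)) := by
        refine Tendsto.const_mul _ ((hq.tendsto_atBot_zero h0 hmono hf).comp ?_)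
        exact tendsto_neg_atTop_atBot.comp
          (tendsto_natCast_atTop_atTop.comp (tendsto_sub_atTop_nat L))
      have h3 := (h1.add h2).div_const (scaleFn q j L)
      rw [mul_zero, add_zero] at h3
      refine h3.congr' ?_
      filter_upwards [eventually_ge_atTop L] with m hm
      simp only [Function.comp]
      rw [Nat.cast_sub hm]
      ring
    filter_upwards [hshift.eventually (gt_mem_nhds hLb), eventually_ge_atTop L] with m hm hmL
    exact (mul_le_mul_of_nonneg_left (hup L m hL1 hmL) m.cast_nonneg).trans_lt hm

end IsStepLaw

/-! ### Reaching a level in a deterministic tree -/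

/-- The label of the node `v`, where `z v` consists of the number of children of `v` and the label
of the edge above `v`, and the root has label `x`. -/
def nodeLabel (x : ℤ) (z : List ℕ → ℕ × ℤ) (v : List ℕ) : ℤ :=
  x + ∑ k ∈ Finset.range v.length, (z (v.take (k + 1))).2

/-- The tree with root label `x` has a node with label at least `m` all of whose strict ancestors
have labels in `S`. -/
def Reaches (S : Set ℤ) (m x : ℤ) (z : List ℕ → ℕ × ℤ) : Prop :=
  ∃ v : List ℕ, (∀ (k : ℕ) (hk : k < v.length), v[k] < (z (v.take k)).1) ∧
    (∀ k < v.length, nodeLabel x z (v.take k) ∈ S) ∧ m ≤ nodeLabel x z v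

lemma nodeLabel_nil (x : ℤ) (z : List ℕ → ℕ × ℤ) : nodeLabel x z [] = x := by simp [nodeLabel]

lemma nodeLabel_cons (x : ℤ) (z : List ℕ → ℕ × ℤ) (i : ℕ) (v : List ℕ) :
    nodeLabel x z (i :: v) = nodeLabel (x + (z [i]).2) (fun w => z (i :: w)) v := by
  rw [nodeLabel, List.length_cons, Finset.sum_range_succ']
  simp only [nodeLabel, List.take_succ_cons, List.take_zero]
  ring

lemma nodeLabel_add (x y : ℤ) (z : List ℕ → ℕ × ℤ) (v : List ℕ) :
    nodeLabel (x + y) z v = x + nodeLabel y z v := by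
  simp only [nodeLabel]
  ring

lemma reaches_of_le {S : Set ℤ} {m x : ℤ} {z : List ℕ → ℕ × ℤ} (h : m ≤ x) : Reaches S m x z :=
  ⟨[], by simp, by simp, by rwa [nodeLabel_nil]⟩

lemma not_reaches_of_notMem {S : Set ℤ} {m x : ℤ} {z : List ℕ → ℕ × ℤ} (h : x < m) (hx : x ∉ S) :
    ¬ Reaches S m x z := by
  rintro ⟨v, -, h1, h2⟩
  rcases v with _ | ⟨i, v⟩
  · rw [nodeLabel_nil] at h2
    omega
  · exact hx (by simpa [nodeLabel_nil] using h1 0 (by simp))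

/-- Branching at the first generation. The field of the i-th subtree stores at its own root the edge
leading to it, whence the start label x + (z [i]).2. -/
lemma reaches_iff {S : Set ℤ} {m x : ℤ} {z : List ℕ → ℕ × ℤ} (h : x < m) (hx : x ∈ S) :
    Reaches S m x z ↔
      ∃ i < (z []).1, Reaches S m (x + (z [i]).2) (fun w => z (i :: w)) := by
  constructor
  · rintro ⟨v, h1, h2, h3⟩
    rcases v with _ | ⟨i, v⟩
    · rw [nodeLabel_nil] at h3
      omega
    · refine ⟨i, h1 0 (by simp), v, fun k hk => ?_, fun k hk => ?_, ?_⟩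
      · exact h1 (k + 1) (by simpa using hk)
      · have := h2 (k + 1) (by simpa using hk)
        rwa [List.take_succ_cons, nodeLabel_cons] at this
      · rwa [nodeLabel_cons] at h3
  · rintro ⟨i, hi, v, h1, h2, h3⟩
    refine ⟨i :: v, fun k hk => ?_, fun k hk => ?_, ?_⟩
    · rcases k with _ | k
      · simpa using hi
      · simpa using h1 k (by simpa using hk)
    · rcases k with _ | k
      · simpa [nodeLabel_nil] using hx
      · rw [List.take_succ_cons, nodeLabel_cons]
        exact h2 k (by simpa using hk)
    · rwa [nodeLabel_cons]

lemma Reaches.mono {S T : Set ℤ} (hST : S ⊆ T) {m x : ℤ} {z : List ℕ → ℕ × ℤ}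
    (h : Reaches S m x z) : Reaches T m x z := by
  obtain ⟨v, h1, h2, h3⟩ := h
  exact ⟨v, h1, fun k hk => hST (h2 k hk), h3⟩

lemma Reaches.translate {m x y d : ℤ} {z : List ℕ → ℕ × ℤ} (h : Reaches Set.univ m x z)
    (hd : d + x ≤ y) : Reaches Set.univ (d + m) y z := by
  obtain ⟨v, h1, -, h3⟩ := h
  refine ⟨v, h1, fun _ _ => Set.mem_univ _, ?_⟩
  have e := nodeLabel_add (y - x) x z v
  rw [sub_add_cancel] at e
  omega

lemma measurable_nodeLabel {X : (List ℕ → ℕ × ℤ) → ℤ} (hX : Measurable X) (v : List ℕ) :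
    Measurable fun z => nodeLabel (X z) z v := by
  unfold nodeLabel
  fun_prop

/-- The start label may depend on the field, as it does for subtrees. -/
lemma measurableSet_reaches (S : Set ℤ) (m : ℤ) {X : (List ℕ → ℕ × ℤ) → ℤ} (hX : Measurable X) :
    MeasurableSet {z | Reaches S m (X z) z} := by
  simp only [Reaches, Set.ofPred_exists, Set.ofPred_and, Set.ofPred_forall]
  refine MeasurableSet.iUnion fun v => ((MeasurableSet.iInter fun k => MeasurableSet.iInter
    fun hk => ?_).inter ((MeasurableSet.iInter fun k => MeasurableSet.iInter fun hk => ?_).inter ?_))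
  · exact (measurable_pi_apply (v.take k)).fst (MeasurableSet.of_discrete (s := {n | v[k] < n}))
  · exact measurable_nodeLabel hX (v.take k) (MeasurableSet.of_discrete (s := S))
  · exact measurable_nodeLabel hX v (MeasurableSet.of_discrete (s := {n | m ≤ n}))

/-! ### The recursion for the reaching probabilities -/

/-- The random variables `Z v`, consisting of the number of children of `v` and the label of the
edge above `v`, are i.i.d.; their components are independent, the first is geometric with
parameter `1/2` and the second takes the value `1 - k` with probability `q k`, `k < j + 2`. -/
structure IsTreeField {Ω : Type*} [MeasurableSpace Ω] (P : Measure Ω) (Z : List ℕ → Ω → ℕ × ℤ)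
    (q : ℕ → ℝ) (j : ℕ) : Prop where
  measurable : ∀ v, Measurable (Z v)
  iIndepFun : iIndepFun Z P
  map_eq : ∀ v, P.map (Z v) = P.map (Z [])
  geometric : ∀ (n : ℕ) (C : Set ℤ), P.real {ω | (Z [] ω).1 = n ∧ (Z [] ω).2 ∈ C}
    = (1 / 2) ^ (n + 1) * P.real {ω | (Z [] ω).2 ∈ C}
  support : ∀ᵐ ω ∂P, ∃ k ∈ Finset.range (j + 2), (Z [] ω).2 = 1 - (k : ℤ)
  weight : ∀ k ∈ Finset.range (j + 2), P.real {ω | (Z [] ω).2 = 1 - (k : ℤ)} = q k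

namespace IsTreeField

variable {Ω : Type*} [MeasurableSpace Ω] {P : Measure Ω}
  {Z : List ℕ → Ω → ℕ × ℤ} {q : ℕ → ℝ} {j : ℕ}

lemma measurable_subtree (hZ : IsTreeField P Z q j) (i : ℕ) :
    Measurable fun ω v => Z (i :: v) ω :=
  measurable_pi_lambda _ fun v => hZ.measurable (i :: v)

lemma measurableSet_reaches_field (hZ : IsTreeField P Z q j) (S : Set ℤ) (m : ℤ)
    {X : (List ℕ → ℕ × ℤ) → ℤ} (hX : Measurable X) :
    MeasurableSet {ω | Reaches S m (X fun v => Z v ω) (fun v => Z v ω)} :=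
  measurable_pi_lambda _ hZ.measurable (measurableSet_reaches S m hX)

/-- Both fields have the same infinite product measure as their law. -/
lemma measureReal_subtree (hZ : IsTreeField P Z q j) (i : ℕ) {B : Set (List ℕ → ℕ × ℤ)}
    (hB : MeasurableSet B) :
    P.real {ω | (fun v => Z (i :: v) ω) ∈ B} = P.real {ω | (fun v => Z v ω) ∈ B} := by
  have h1 := (hZ.iIndepFun.precomp (List.cons_injective (a := i))).map_fun_eq_infinitePi_map
    (fun v => hZ.measurable (i :: v))
  have h2 := hZ.iIndepFun.map_fun_eq_infinitePi_map hZ.measurable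
  simp_rw [hZ.map_eq] at h1 h2
  have h3 := congrArg (fun ν => ν.real B) (h1.trans h2.symm)
  rwa [map_measureReal_apply (hZ.measurable_subtree i) hB,
    map_measureReal_apply (measurable_pi_lambda _ hZ.measurable) hB] at h3

lemma measureReal_root_and_subtrees (hZ : IsTreeField P Z q j) {B : Set (List ℕ → ℕ × ℤ)}
    (hB : MeasurableSet B) (C : Set (ℕ × ℤ)) (n : ℕ) :
    P.real {ω | Z [] ω ∈ C ∧ ∀ i < n, (fun v => Z (i :: v) ω) ∈ B}
      = P.real {ω | Z [] ω ∈ C} * P.real {ω | (fun v => Z v ω) ∈ B} ^ n := by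
  induction n with
  | zero => simp
  | succ n ih =>
    let m : List ℕ → MeasurableSpace Ω := fun v => MeasurableSpace.comap (Z v) inferInstance
    -- S indexes the root and the first n subtrees, T the next subtree; disjoint index sets give
    -- independence.
    let S : Set (List ℕ) := {v | v = [] ∨ ∃ i < n, ∃ w, v = i :: w}
    let T : Set (List ℕ) := {v | ∃ w, v = n :: w}
    have hST : Disjoint S T := by
      rw [Set.disjoint_left]
      rintro v (rfl | ⟨i, hi, w, rfl⟩) ⟨w', h⟩
      · simp at h
      · simp only [List.cons.injEq] at h
        omega
    have hind : Indep (⨆ v ∈ S, m v) (⨆ v ∈ T, m v) P :=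
      indep_iSup_of_disjoint (fun v => (hZ.measurable v).comap_le) hZ.iIndepFun.iIndep hST
    have hmeas : ∀ (R : Set (List ℕ)) (v : List ℕ), v ∈ R → Measurable[⨆ v ∈ R, m v] (Z v) :=
      fun R v hv => (comap_measurable (Z v)).mono (le_iSup₂ (f := fun v _ => m v) v hv) le_rfl
    have hsub : ∀ (R : Set (List ℕ)) (i : ℕ), (∀ v, i :: v ∈ R) →
        MeasurableSet[⨆ v ∈ R, m v] {ω | (fun v => Z (i :: v) ω) ∈ B} := fun R i hi =>
      (@measurable_pi_lambda _ _ _ (⨆ v ∈ R, m v) _ _ fun v => hmeas R (i :: v) (hi v)) hB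
    have h1 : MeasurableSet[⨆ v ∈ S, m v]
        {ω | Z [] ω ∈ C ∧ ∀ i < n, (fun v => Z (i :: v) ω) ∈ B} := by
      simp only [Set.ofPred_and, Set.ofPred_forall]
      refine MeasurableSet.inter (hmeas S [] (Or.inl rfl) (MeasurableSet.of_discrete (s := C))) ?_
      exact MeasurableSet.iInter fun i => MeasurableSet.iInter fun hi =>
        hsub S i fun v => Or.inr ⟨i, hi, v, rfl⟩
    have h2 := hsub T n fun v => ⟨v, rfl⟩
    have h3 := congrArg ENNReal.toReal ((Indep_iff _ _ _).1 hind _ _ h1 h2)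
    rw [ENNReal.toReal_mul] at h3
    change P.real _ = P.real _ * P.real _ at h3
    rw [ih, hZ.measureReal_subtree n hB] at h3
    rw [pow_succ, ← mul_assoc, ← h3]
    congr 1
    ext ω
    simp only [Set.mem_ofPred_eq, Set.mem_inter_iff, Nat.lt_succ_iff_lt_or_eq, or_imp, forall_and,
      forall_eq, and_assoc]

variable [IsProbabilityMeasure P]

/-- Summation over the number n of children: ∑ 2^{-(n+1)} b^n = 1/(2 - b). -/
lemma measureReal_all_subtrees (hZ : IsTreeField P Z q j) {B : Set (List ℕ → ℕ × ℤ)}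
    (hB : MeasurableSet B) (C : Set ℤ) :
    P.real {ω | (Z [] ω).2 ∈ C ∧ ∀ i < (Z [] ω).1, (fun v => Z (i :: v) ω) ∈ B}
      = P.real {ω | (Z [] ω).2 ∈ C} / (2 - P.real {ω | (fun v => Z v ω) ∈ B}) := by
  set b := P.real {ω | (fun v => Z v ω) ∈ B}
  have hb0 : 0 ≤ b := measureReal_nonneg
  have hb1 : b ≤ 1 := measureReal_le_one
  let E : ℕ → Set Ω := fun n =>
    {ω | Z [] ω ∈ {y : ℕ × ℤ | y.1 = n ∧ y.2 ∈ C} ∧ ∀ i < n, (fun v => Z (i :: v) ω) ∈ B}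
  have hE : {ω | (Z [] ω).2 ∈ C ∧ ∀ i < (Z [] ω).1, (fun v => Z (i :: v) ω) ∈ B} = ⋃ n, E n := by
    ext ω
    simp only [E, Set.mem_ofPred_eq, Set.mem_iUnion]
    constructor
    · rintro ⟨h1, h2⟩
      exact ⟨_, ⟨rfl, h1⟩, h2⟩
    · rintro ⟨n, ⟨rfl, h1⟩, h2⟩
      exact ⟨h1, h2⟩
  have hEm : ∀ n, MeasurableSet (E n) := by
    intro n
    simp only [E, Set.ofPred_and, Set.ofPred_forall]
    exact (hZ.measurable [] (MeasurableSet.of_discrete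
      (s := {y : ℕ × ℤ | y.1 = n ∧ y.2 ∈ C}))).inter <|
      MeasurableSet.iInter fun i => MeasurableSet.iInter fun _ => hZ.measurable_subtree i hB
  have hEd : Pairwise (Function.onFun Disjoint E) := by
    intro n n' hne
    refine Set.disjoint_left.2 fun ω h1 h2 => hne ?_
    exact h1.1.1.symm.trans h2.1.1
  have hEv : ∀ n, P.real (E n) = P.real {ω | (Z [] ω).2 ∈ C} / 2 * (b / 2) ^ n := by
    intro n
    rw [hZ.measureReal_root_and_subtrees hB]
    have := hZ.geometric n C
    simp only [Set.mem_ofPred_eq]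
    rw [this, pow_succ, div_pow, div_pow, one_pow]
    ring
  have hsum : HasSum (fun n => P.real (E n))
      (P.real {ω | (Z [] ω).2 ∈ C} / 2 * (1 - b / 2)⁻¹) := by
    simp_rw [hEv]
    exact (hasSum_geometric_of_lt_one (by linarith) (by linarith)).mul_left _
  rw [hE, measureReal_def, measure_iUnion hEd hEm, ENNReal.tsum_toReal_eq (by simp)]
  refine hsum.tsum_eq.trans ?_
  have : 2 - b ≠ 0 := by linarith
  have : 1 - b / 2 ≠ 0 := by linarith
  field_simp

/-- The probability that the tree with root label `x` reaches `m` with ancestors labelled in `S`. -/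
noncomputable def reachProb (P : Measure Ω) (Z : List ℕ → Ω → ℕ × ℤ) (S : Set ℤ) (m x : ℤ) : ℝ :=
  P.real {ω | Reaches S m x (fun v => Z v ω)}

lemma measureReal_edge_and_not_reaches (hZ : IsTreeField P Z q j) {S : Set ℤ} {m x : ℤ}
    (hxm : x < m) (hx : x ∈ S) (C : Set ℤ) :
    P.real {ω | (Z [] ω).2 ∈ C ∧ ¬ Reaches S m x (fun v => Z v ω)}
      = P.real {ω | (Z [] ω).2 ∈ C} /
        (1 + P.real {ω | Reaches S m (x + (Z [] ω).2) (fun v => Z v ω)}) := by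
  have hX : Measurable fun z : List ℕ → ℕ × ℤ => x + (z []).2 := by fun_prop
  have h := hZ.measureReal_all_subtrees (measurableSet_reaches S m hX).compl C
  have e : P.real {ω | (fun v => Z v ω) ∈ {z | Reaches S m (x + (z []).2) z}ᶜ}
      = 1 - P.real {ω | Reaches S m (x + (Z [] ω).2) (fun v => Z v ω)} :=
    probReal_compl_eq_one_sub (hZ.measurableSet_reaches_field S m hX)
  rw [e] at h
  convert! h using 2
  · congr 1
    ext ω
    simp [reaches_iff hxm hx]
  · ring

lemma one_sub_reachProb (hZ : IsTreeField P Z q j) (S : Set ℤ) (m x : ℤ) :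
    P.real {ω | ¬ Reaches S m x (fun v => Z v ω)} = 1 - reachProb P Z S m x :=
  probReal_compl_eq_one_sub (hZ.measurableSet_reaches_field S m measurable_const)

/-- With a fixed start label the edge stored at the root plays no role in the event, hence
independence; it is read off by comparing `measureReal_edge_and_not_reaches` for C and for the whole
of ℤ. -/
lemma measureReal_edge_and_reaches (hZ : IsTreeField P Z q j) (S : Set ℤ) (m x : ℤ) (C : Set ℤ) :
    P.real {ω | (Z [] ω).2 ∈ C ∧ Reaches S m x (fun v => Z v ω)}
      = P.real {ω | (Z [] ω).2 ∈ C} * reachProb P Z S m x := by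
  rcases le_or_gt m x with h | h
  · simp [reachProb, reaches_of_le h]
  by_cases hx : x ∈ S
  · have h1 := hZ.measureReal_edge_and_not_reaches h hx C
    have h2 := hZ.measureReal_edge_and_not_reaches h hx Set.univ
    simp only [Set.mem_univ, true_and, Set.ofPred_true, probReal_univ,
      hZ.one_sub_reachProb] at h2
    have h3 := measureReal_inter_add_sdiff (μ := P) (s := {ω | (Z [] ω).2 ∈ C})
      (hZ.measurableSet_reaches_field S m (measurable_const (a := x)))
    have h4 : P.real ({ω | (Z [] ω).2 ∈ C} \ {ω | Reaches S m x (fun v => Z v ω)})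
        = P.real {ω | (Z [] ω).2 ∈ C} * (1 - reachProb P Z S m x) := by
      rw [h2, mul_one_div]
      exact h1
    rw [h4] at h3
    have h5 : P.real {ω | (Z [] ω).2 ∈ C ∧ Reaches S m x (fun v => Z v ω)}
      = P.real ({ω | (Z [] ω).2 ∈ C} ∩ {ω | Reaches S m x (fun v => Z v ω)}) := rfl
    linarith
  · simp [reachProb, not_reaches_of_notMem h hx]

lemma measureReal_reaches_add_edge (hZ : IsTreeField P Z q j) (S : Set ℤ) (m x : ℤ) :
    P.real {ω | Reaches S m (x + (Z [] ω).2) (fun v => Z v ω)}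
      = walkOp q j (reachProb P Z S m) x := by
  let E : ℕ → Set Ω := fun k =>
    {ω | (Z [] ω).2 ∈ ({1 - (k : ℤ)} : Set ℤ) ∧ Reaches S m (x + 1 - k) (fun v => Z v ω)}
  have hae : {ω | Reaches S m (x + (Z [] ω).2) (fun v => Z v ω)}
      =ᵐ[P] ⋃ k ∈ Finset.range (j + 2), E k := by
    refine eventuallyEq_set.2 ?_
    filter_upwards [hZ.support] with ω hω
    obtain ⟨k, hk, hk'⟩ := hω
    simp only [E, Set.mem_iUnion, Set.mem_ofPred_eq, Set.mem_singleton_iff, exists_prop]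
    constructor
    · intro h
      exact ⟨k, hk, hk', by rwa [hk', ← add_sub_assoc] at h⟩
    · rintro ⟨k', -, h1, h2⟩
      rwa [h1, ← add_sub_assoc]
  rw [measureReal_congr hae, measureReal_biUnion_finset]
  · refine Finset.sum_congr rfl fun k hk => ?_
    rw [hZ.measureReal_edge_and_reaches, ← hZ.weight k hk]
    rfl
  · intro k _ k' _ hne
    refine Set.disjoint_left.2 fun ω h1 h2 => hne ?_
    have := h1.1.symm.trans h2.1
    omega
  · intro k _
    exact ((hZ.measurable []).snd (MeasurableSet.of_discrete (s := {1 - (k : ℤ)}))).inter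
      (hZ.measurableSet_reaches_field S m measurable_const)

lemma reachProb_eq (hZ : IsTreeField P Z q j) {S : Set ℤ} {m x : ℤ} (hxm : x < m) (hx : x ∈ S) :
    reachProb P Z S m x = walkOp q j (reachProb P Z S m) x /
      (1 + walkOp q j (reachProb P Z S m) x) := by
  have h := hZ.measureReal_edge_and_not_reaches hxm hx Set.univ
  simp only [Set.mem_univ, true_and, Set.ofPred_true, probReal_univ,
    hZ.one_sub_reachProb] at h
  rw [hZ.measureReal_reaches_add_edge] at h
  have h0 : 0 ≤ walkOp q j (reachProb P Z S m) x := by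
    rw [← hZ.measureReal_reaches_add_edge]
    exact measureReal_nonneg
  rw [sub_eq_iff_eq_add, eq_comm, ← eq_sub_iff_add_eq'] at h
  rw [h]
  have : 1 + walkOp q j (reachProb P Z S m) x ≠ 0 := by linarith
  field_simp
  ring

theorem tendsto_mul_reachProb (hZ : IsTreeField P Z q j) {μ : ℝ} (hq : IsStepLaw q j μ) :
    Tendsto (fun m : ℕ => (m : ℝ) * reachProb P Z {y | 1 ≤ y} m 1) atTop (𝓝 (μ ^ 2 / q 0)) := by
  refine hq.tendsto_mul_killed (f := reachProb P Z Set.univ 0)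
    (h := fun m => reachProb P Z {y | 1 ≤ y} m) (fun _ => measureReal_nonneg) ?_ ?_ ?_
    (fun _ _ => measureReal_nonneg) ?_ ?_ ?_ ?_
  · intro x y hxy
    refine measureReal_mono fun ω h => ?_
    rw [Set.mem_ofPred_eq] at h ⊢
    simpa using h.translate (d := 0) (by simpa using hxy)
  · simp [reachProb, reaches_of_le le_rfl]
  · exact fun x hx => hZ.reachProb_eq hx (Set.mem_univ x)
  · intro m x
    refine measureReal_mono fun ω h => ?_
    rw [Set.mem_ofPred_eq] at h ⊢
    have := Reaches.translate (d := -m) (h.mono (Set.subset_univ _)) (y := x - m) (by omega)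
    simpa using this
  · intro m hm x hx
    simp [reachProb, not_reaches_of_notMem (show x < m by omega)
      (show x ∉ {y : ℤ | 1 ≤ y} from fun h => by simp only [Set.mem_ofPred_eq] at h; omega)]
  · intro m
    simp [reachProb, reaches_of_le le_rfl]
  · exact fun m x h1 h2 => hZ.reachProb_eq h2 h1

end IsTreeField

/-! ### The barrier tree in terms of `Reaches` -/

section Tree

variable {N : List ℕ → ℕ} {ξ : List ℕ → ℝ} {z : List ℕ → ℕ × ℤ}

lemma label_treeOf (hz : ∀ v, ξ v = (z v).2) (x : ℤ) (v : List ℕ) :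
    (treeOf x N ξ).label v = nodeLabel x z v := by
  simp [LabelledTree.label, treeOf, nodeLabel, hz]

lemma LabelledTree.take_mem (T : LabelledTree) {v : List ℕ} (hv : v ∈ T.nodes) (k : ℕ) :
    v.take k ∈ T.nodes := by
  induction v using List.reverseRecOn with
  | nil => simpa using T.root_mem
  | append_singleton v i ih =>
    rcases le_or_gt k v.length with h | h
    · rw [List.take_append_of_le_length h]
      exact ih (T.parent_mem v i hv)
    · rwa [List.take_of_length_le (by simpa using h)]

/-- If some strict ancestor of v lies below the root label, then the first such ancestor is killed,
so v is removed. -/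
lemma LabelledTree.mem_barrier_iff (T : LabelledTree) (v : List ℕ) :
    v ∈ T.barrier.nodes ↔ v ∈ T.nodes ∧ ∀ k < v.length, T.label [] ≤ T.label (v.take k) := by
  constructor
  · rintro ⟨hv, hk⟩
    refine ⟨hv, ?_⟩
    by_contra! hcon
    classical
    obtain ⟨hlen, hlt⟩ := Nat.find_spec hcon
    set k := Nat.find hcon
    have hkill : v.take k ∈ T.killed := by
      refine ⟨T.take_mem hv k, fun w hw hne => ?_, hlt⟩
      have hle := hw.length_le
      rw [List.length_take_of_le hlen.le] at hle
      have hw' : w = v.take w.length := List.prefix_iff_eq_take.1 (hw.trans (List.take_prefix k v))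
      rcases Nat.lt_or_eq_of_le hle with h | h
      · have := Nat.find_min hcon h
        push Not at this
        rw [hw']
        exact this (h.trans hlen)
      · exact absurd (by rw [hw', h]) hne
    have := congrArg List.length (hk _ hkill (List.take_prefix k v))
    rw [List.length_take_of_le hlen.le] at this
    omega
  · rintro ⟨hv, hk⟩
    refine ⟨hv, fun w hw hwv => ?_⟩
    by_contra hne
    have hw' := List.prefix_iff_eq_take.1 hwv
    have hlen : w.length < v.length := lt_of_le_of_ne hwv.length_le fun h => hne (by
      rw [hw', h, List.take_length])
    have := hk _ hlen
    rw [← hw'] at this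
    exact absurd hw.2.2 this.not_gt

/-- Labels are integers, so if no label attains ⌈u⌉, the supremum is at most ⌈u⌉ - 1 < u, whether or
not it is attained. -/
lemma le_maxLabel_barrier_iff (hN : ∀ v, N v = (z v).1) (hz : ∀ v, ξ v = (z v).2) (u : ℝ) :
    (u : EReal) ≤ (treeOf 1 N ξ).barrier.maxLabel ↔ Reaches {y | 1 ≤ y} ⌈u⌉ 1 z := by
  have hlabel : ∀ v, (treeOf 1 N ξ).label v = nodeLabel 1 z v := fun v => by
    simpa using label_treeOf (N := N) hz 1 v
  have hbar : ∀ v, (treeOf 1 N ξ).barrier.label v = nodeLabel 1 z v := hlabel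
  have hmem : ∀ v, v ∈ (treeOf 1 N ξ).barrier.nodes ↔
      (∀ (k : ℕ) (hk : k < v.length), v[k] < (z (v.take k)).1) ∧
        ∀ k < v.length, nodeLabel 1 z (v.take k) ∈ {y : ℤ | 1 ≤ y} := by
    intro v
    rw [LabelledTree.mem_barrier_iff]
    simp_rw [hlabel, ← hN, nodeLabel_nil, Int.cast_le]
    rfl
  constructor
  · intro h
    by_contra hcon
    have hle : (treeOf 1 N ξ).barrier.maxLabel ≤ ((⌈u⌉ - 1 : ℤ) : ℝ) := by
      refine iSup₂_le fun v hv => ?_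
      rw [hbar, EReal.coe_le_coe_iff, Int.cast_le]
      by_contra! hv'
      exact hcon ⟨v, ((hmem v).1 hv).1, ((hmem v).1 hv).2, by omega⟩
    have := EReal.coe_le_coe_iff.1 (h.trans hle)
    push_cast at this
    linarith [Int.ceil_lt_add_one u]
  · rintro ⟨v, h1, h2, h3⟩
    refine le_trans ?_ (le_iSup₂ (f := fun v _ => (((treeOf 1 N ξ).barrier.label v : ℝ) : EReal))
      v ((hmem v).2 ⟨h1, h2⟩))
    rw [hbar, EReal.coe_le_coe_iff]
    exact (Int.le_ceil u).trans (by exact_mod_cast h3)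

end Tree

/-! ### Reduction to an integer-valued field and conclusion -/

/-- Pairing two independent families of independent random variables. -/
lemma iIndepFun_prodMk_of_indepFun {Ω ι α β : Type*} [MeasurableSpace Ω] {P : Measure Ω}
    [MeasurableSpace α] [MeasurableSpace β] {X : ι → Ω → α} {Y : ι → Ω → β}
    (hX : ∀ i, Measurable (X i)) (hY : ∀ i, Measurable (Y i)) (hXi : iIndepFun X P)
    (hYi : iIndepFun Y P) (hXY : IndepFun (fun ω i => X i ω) (fun ω i => Y i ω) P) :
    iIndepFun (fun i ω => (X i ω, Y i ω)) P := by
  -- Measurable rectangles form a generating π-system on which independence factorises.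
  let π : ι → Set (Set Ω) := fun i => Set.preimage (fun ω => (X i ω, Y i ω)) ''
    (Set.image2 (· ×ˢ ·) {s : Set α | MeasurableSet s} {t : Set β | MeasurableSet t})
  refine iIndepSets.iIndep (fun i => ((hX i).prodMk (hY i)).comap_le) π
    (fun i => ?_) (fun i => ?_) ?_
  · rintro _ ⟨s, hs, rfl⟩ _ ⟨t, ht, rfl⟩ hne
    rw [← Set.preimage_inter] at hne ⊢
    exact ⟨_, isPiSystem_prod _ hs _ ht (hne.elim fun _ hω => ⟨_, hω⟩), rfl⟩
  · rw [← generateFrom_prod, MeasurableSpace.comap_generateFrom]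
  · rw [iIndepSets_iff]
    intro S f hf
    have hf' : ∀ i, ∃ (s : Set α) (t : Set β), MeasurableSet s ∧ MeasurableSet t ∧
        (i ∈ S → f i = X i ⁻¹' s ∩ Y i ⁻¹' t) := by
      intro i
      by_cases hi : i ∈ S
      · obtain ⟨_, ⟨s, hs, t, ht, rfl⟩, h⟩ := hf i hi
        exact ⟨s, t, hs, ht, fun _ => h.symm⟩
      · exact ⟨∅, ∅, .empty, .empty, fun h => absurd h hi⟩
    choose s t hs ht hst using hf'
    have hinter : ⋂ i ∈ S, f i
        = (fun ω i => X i ω) ⁻¹' (⋂ i ∈ S, {x | x i ∈ s i}) ∩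
          (fun ω i => Y i ω) ⁻¹' (⋂ i ∈ S, {y | y i ∈ t i}) := by
      rw [Set.iInter₂_congr hst]
      ext ω
      simp [forall_and]
    have hsing : ∀ i ∈ S, P (f i) = P (X i ⁻¹' s i) * P (Y i ⁻¹' t i) := by
      intro i hi
      rw [hst i hi]
      exact (hXY.comp (measurable_pi_apply i) (measurable_pi_apply i)).measure_inter_preimage_eq_mul
        _ _ (hs i) (ht i)
    rw [hinter, hXY.measure_inter_preimage_eq_mul, Finset.prod_congr rfl hsing,
      Finset.prod_mul_distrib, ← hXi.measure_inter_preimage_eq_mul S (fun i _ => hs i),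
      ← hYi.measure_inter_preimage_eq_mul S (fun i _ => ht i)]
    · simp only [Set.preimage_iInter]
      rfl
    · exact Finset.measurableSet_biInter _ fun i _ => measurable_pi_apply i (hs i)
    · exact Finset.measurableSet_biInter _ fun i _ => measurable_pi_apply i (ht i)

lemma integral_comp_eq_sum {Ω : Type*} [MeasurableSpace Ω] {P : Measure Ω} [IsProbabilityMeasure P]
    {Y : Ω → ℤ} (hY : Measurable Y) {j : ℕ}
    (hsupp : ∀ᵐ ω ∂P, ∃ k ∈ Finset.range (j + 2), Y ω = 1 - (k : ℤ)) (g : ℤ → ℝ) :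
    ∫ ω, g (Y ω) ∂P
      = ∑ k ∈ Finset.range (j + 2), P.real {ω | Y ω = 1 - (k : ℤ)} * g (1 - (k : ℤ)) := by
  have hm : ∀ k : ℕ, MeasurableSet {ω | Y ω = 1 - (k : ℤ)} := fun k =>
    hY (MeasurableSet.of_discrete (s := {1 - (k : ℤ)}))
  have hae : (fun ω => g (Y ω)) =ᵐ[P] fun ω => ∑ k ∈ Finset.range (j + 2),
      {ω | Y ω = 1 - (k : ℤ)}.indicator (fun _ => g (1 - (k : ℤ))) ω := by
    filter_upwards [hsupp] with ω ⟨k, hk, hω⟩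
    rw [Finset.sum_eq_single_of_mem k hk]
    · rw [Set.indicator_of_mem (by exact hω), hω]
    · intro k' _ hne
      refine Set.indicator_of_notMem (fun h => hne ?_) _
      rw [Set.mem_ofPred_eq] at h
      omega
  rw [integral_congr_ae hae, integral_finsetSum]
  · refine Finset.sum_congr rfl fun k _ => ?_
    rw [integral_indicator_const _ (hm k), smul_eq_mul]
  · exact fun k _ => (integrable_const _).indicator (hm k)

theorem mainTheorem2
    {Ω' : Type*} [MeasurableSpace Ω'] (P' : Measure Ω') [IsProbabilityMeasure P']
    (J : Ω' → ℝ) (j : ℕ)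
    (hJ : ∀ᵐ ω ∂P', ∃ z : ℤ, -(j : ℤ) ≤ z ∧ z ≤ 1 ∧ J ω = z)
    (hJpos : 0 < P'[J])
    {Ω : Type*} [MeasurableSpace Ω] (P : Measure Ω) [IsProbabilityMeasure P]
    (N : List ℕ → Ω → ℕ) (ξ : List ℕ → Ω → ℝ)
    (hN : ∀ v, AEMeasurable (N v) P ∧ ∀ k : ℕ, P.real {ω | N v ω = k} = (1 / 2 : ℝ) ^ (k + 1))
    (hξ : ∀ v, IdentDistrib (ξ v) J P P')
    (hNindep : iIndepFun N P)
    (hξindep : iIndepFun ξ P)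
    (hNξ : IndepFun (fun ω v => N v ω) (fun ω v => ξ v ω) P) :
    Tendsto
      (fun u : ℝ => u * P.real {ω | (u : EReal) ≤
        (treeOf 1 (fun v => N v ω) (fun v => ξ v ω)).barrier.maxLabel})
      atTop (𝓝 (P'[J] ^ 2 / P'.real {ω | J ω = 1})) := by
  -- Measurable versions, with edge labels floored to integers. There are countably many nodes, so
  -- almost surely nothing changes on the whole tree.
  set M : List ℕ → Ω → ℕ := fun v => (hN v).1.mk (N v)
  set η : List ℕ → Ω → ℤ := fun v ω => ⌊(hξ v).aemeasurable_fst.mk (ξ v) ω⌋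
  have hMm : ∀ v, Measurable (M v) := fun v => (hN v).1.measurable_mk
  have hηm : ∀ v, Measurable (η v) := fun v =>
    Int.measurable_floor.comp (hξ v).aemeasurable_fst.measurable_mk
  have hNM : ∀ v, N v =ᵐ[P] M v := fun v => (hN v).1.ae_eq_mk
  have hηfl : ∀ v, (fun ω => ⌊ξ v ω⌋) =ᵐ[P] η v := fun v =>
    (hξ v).aemeasurable_fst.ae_eq_mk.fun_comp _
  have hsupp : ∀ v, ∀ᵐ ω ∂P, (∃ k ∈ Finset.range (j + 2), η v ω = 1 - (k : ℤ)) ∧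
      ξ v ω = η v ω := by
    intro v
    have hset : MeasurableSet (⋃ z ∈ Set.Icc (-(j : ℤ)) 1, {(z : ℝ)}) :=
      MeasurableSet.biUnion (Set.to_countable _) fun z _ => measurableSet_singleton _
    have hJ' : ∀ᵐ ω ∂P', J ω ∈ ⋃ z ∈ Set.Icc (-(j : ℤ)) 1, {(z : ℝ)} := by
      filter_upwards [hJ] with ω ⟨z, h1, h2, h3⟩
      simp only [Set.mem_iUnion]
      exact ⟨z, ⟨h1, h2⟩, h3⟩
    filter_upwards [(hξ v).symm.ae_mem_snd hset hJ', hηfl v] with ω hω hω'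
    simp only [Set.mem_iUnion] at hω
    obtain ⟨z, ⟨h1, h2⟩, h3⟩ := hω
    rw [Set.mem_singleton_iff] at h3
    rw [h3, Int.floor_intCast] at hω'
    rw [← hω']
    exact ⟨⟨(1 - z).toNat, Finset.mem_range.2 (by omega), by omega⟩, h3⟩
  have hMi : iIndepFun M P := hNindep.congr hNM
  have hηi : iIndepFun η P :=
    (hξindep.comp (fun _ => Int.floor) fun _ => Int.measurable_floor).congr hηfl
  have hMη : IndepFun (fun ω v => M v ω) (fun ω v => η v ω) P := by
    have hfl : Measurable fun (y : List ℕ → ℝ) v => ⌊y v⌋ :=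
      measurable_pi_lambda _ fun v => Int.measurable_floor.comp (measurable_pi_apply v)
    refine (hNξ.comp measurable_id hfl).congr ?_ ?_
    · filter_upwards [ae_all_iff.2 hNM] with ω hω using funext hω
    · filter_upwards [ae_all_iff.2 hηfl] with ω hω using funext hω
  have hMη' : ∀ v, IndepFun (M v) (η v) P := fun v =>
    hMη.comp (measurable_pi_apply v) (measurable_pi_apply v)
  have hMlaw : ∀ v k, P.real {ω | M v ω = k} = (1 / 2 : ℝ) ^ (k + 1) := by
    intro v k
    rw [← (hN v).2 k]
    refine measureReal_congr (eventuallyEq_set.2 ?_)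
    filter_upwards [hNM v] with ω hω
    simp only [hω]
  have hηlaw : ∀ v, IdentDistrib (η v) (fun ω => ⌊J ω⌋) P P' := fun v =>
    (IdentDistrib.of_ae_eq (hηm v).aemeasurable (hηfl v).symm).trans
      ((hξ v).comp Int.measurable_floor)
  set q : ℕ → ℝ := fun k => P.real {ω | η [] ω = 1 - (k : ℤ)} with hqdef
  have hsupp0 : ∀ᵐ ω ∂P, ∃ k ∈ Finset.range (j + 2), η [] ω = 1 - (k : ℤ) :=
    (hsupp []).mono fun ω h => h.1
  have hmean : ∫ ω, (η [] ω : ℝ) ∂P = P'[J] := by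
    rw [← (hξ []).integral_eq]
    refine integral_congr_ae ?_
    filter_upwards [hsupp []] with ω hω using hω.2.symm
  have hq : IsStepLaw q j P'[J] := by
    refine ⟨fun _ => measureReal_nonneg, ?_, ?_, hJpos⟩
    · simpa using (integral_comp_eq_sum (hηm []) hsupp0 fun _ => 1).symm
    · rw [← hmean, integral_comp_eq_sum (hηm []) hsupp0 fun y => (y : ℝ)]
      simp [hqdef]
  have hq0 : q 0 = P'.real {ω | J ω = 1} := by
    have h1 := congrArg ENNReal.toReal
      ((hξ []).measure_mem_eq (measurableSet_singleton (1 : ℝ)))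
    refine Eq.trans (measureReal_congr (eventuallyEq_set.2 ?_)) h1
    filter_upwards [hsupp []] with ω hω
    simp [hω.2]
  have hZ : IsTreeField P (fun v ω => (M v ω, η v ω)) q j := by
    refine ⟨fun v => (hMm v).prodMk (hηm v), iIndepFun_prodMk_of_indepFun hMm hηm hMi hηi hMη,
      fun v => ?_, fun n C => ?_, hsupp0, fun k _ => rfl⟩
    · rw [(hMη' v).map_prod_eq_prod_map_map (hMm v).aemeasurable (hηm v).aemeasurable,
        (hMη' []).map_prod_eq_prod_map_map (hMm []).aemeasurable (hηm []).aemeasurable,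
        (hηlaw v).map_eq, (hηlaw []).map_eq]
      congr 1
      refine Measure.ext_of_singleton fun k => ?_
      rw [Measure.map_apply (hMm v) (measurableSet_singleton k),
        Measure.map_apply (hMm []) (measurableSet_singleton k),
        ← ENNReal.toReal_eq_toReal_iff' (measure_ne_top _ _) (measure_ne_top _ _)]
      exact (hMlaw v k).trans (hMlaw [] k).symm
    · have h := congrArg ENNReal.toReal ((hMη' []).measure_inter_preimage_eq_mul {n} C
        (MeasurableSet.of_discrete) (MeasurableSet.of_discrete))
      rw [ENNReal.toReal_mul] at h
      rw [← hMlaw [] n]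
      exact h
  have hlim := hZ.tendsto_mul_reachProb hq
  rw [hq0] at hlim
  -- Passage from integer levels to real u: the event depends on u only through ⌈u⌉, and u/⌈u⌉ → 1.
  have hratio : Tendsto (fun u : ℝ => u / (⌈u⌉₊ : ℝ)) atTop (𝓝 1) := by
    have := (tendsto_nat_ceil_div_atTop (R := ℝ)).inv₀ one_ne_zero
    simpa using this
  have hprod := hratio.mul (hlim.comp tendsto_nat_ceil_atTop)
  rw [one_mul] at hprod
  refine hprod.congr' ?_
  filter_upwards [eventually_gt_atTop 0] with u hu
  have hset : P.real {ω | (u : EReal) ≤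
      (treeOf 1 (fun v => N v ω) (fun v => ξ v ω)).barrier.maxLabel}
      = IsTreeField.reachProb P (fun v ω => (M v ω, η v ω)) {y | 1 ≤ y} ⌈u⌉₊ 1 := by
    refine measureReal_congr (eventuallyEq_set.2 ?_)
    filter_upwards [ae_all_iff.2 hNM, ae_all_iff.2 hsupp] with ω h1 h2
    rw [le_maxLabel_barrier_iff (z := fun v => (M v ω, η v ω)) h1 fun v => (h2 v).2,
      Int.natCast_ceil_eq_ceil hu.le]
  rw [hset, Function.comp_apply]
  have : (⌈u⌉₊ : ℝ) ≠ 0 := by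
    have := Nat.ceil_pos.2 hu
    positivity
  field_simp
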